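/- All rings are unital, and "module" means unital left module. A commutative ring $R$ is called \emph{pseudo-noetherian} if for every $a\in R$ the set $V_{\min}(a)$ of prime ideals minimal among those containing $a$ is finite, and for every $\mathfrak p\in V_{\min}(a)$ the localization $R_{\mathfrak p}$ is noetherian. Let $R$ be a reduced pseudo-noetherian ring with full ring of fractions $Q$, and let $A$ be a reduced pseudo-noetherian order over $R$; that is, $A$ is a (not necessarily commutative) $R$-algebra such that (a) the ring $A_{\mathfrak p}$ is (left and right) noetherian for every prime ideal $\mathfrak p$ of $R$ with $\operatorname{ht}\mathfrak p\le 1$, and $Q\otimes_R A$ is a finitely generated $Q$-module; (b) $A$ has no nonzero nilpotent two-sided ideals; (c) $A$ is torsion free over $R$: if $r\in R$ is a non-zero-divisor, $x\in A$ and $rx=0$, then $x=0$. An $A$-module $M$ is called \emph{codivisorial} if the only submodule $N\subseteq M$ with $N_{\mathfrak p}=0$ for all prime ideals $\mathfrak p$ of $R$ of height $1$ is $N=0$. A module is \emph{indecomposable} if it is nonzero and is not a direct sum of two nonzero submodules. Then: 1. Any coproduct (direct sum of an arbitrary family) of indecomposable injective codivisorial $A$-modules is an injective $A$-module. 2. Every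 codivisorial injective $A$-module is a coproduct (direct sum) of indecomposable injective codivisorial submodules. -/

import Mathlib

open scoped DirectSum nonZeroDivisors

universe u v w t

/-- A commutative ring `R` is pseudo-noetherian if for every `a : R` there are only finitely many
primes minimal among those containing `a`, and the localization of `R` at each of them is
noetherian. -/
structure IsPseudoNoetherianRing (R : Type w) [CommRing R] : Prop where
  finite_minimalPrimes : ∀ a : R, (Ideal.span {a}).minimalPrimes.Finite
  isNoetherianRing_localization : ∀ (a : R) (P : Ideal R) [P.IsPrime],
    P ∈ (Ideal.span {a}).minimalPrimes → IsNoetherianRing (Localization.AtPrime P)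

/-- A (not necessarily commutative) `R`-algebra `A` is pseudo-noetherian if the ring `A_P` is (left
and right) noetherian for every prime ideal `P` of `R` of height at most one. -/
def IsPseudoNoetherianAlgebra (R : Type w) (A : Type u) [CommRing R] [Ring A] [Algebra R A] :
    Prop :=
  ∀ (P : Ideal R) [P.IsPrime], P.height ≤ 1 →
    IsNoetherianRing (LocalizedModule P.primeCompl A) ∧
      IsNoetherianRing (LocalizedModule P.primeCompl A)ᵐᵒᵖ

/-- A ring without nonzero nilpotent two-sided ideals. -/
def HasNoNilpotentIdeals (A : Type u) [Ring A] : Prop :=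
  ∀ I : Ideal A, I.IsTwoSided → IsNilpotent I → I = ⊥

/-- `A` is a reduced pseudo-noetherian order over (the reduced pseudo-noetherian ring) `R`: it is a
pseudo-noetherian algebra, `Q ⊗ A` is a finite algebra over the full ring of fractions `Q` of `R`,
`A` has no nonzero nilpotent ideals, and `A` is torsion free as an `R`-module. -/
structure IsReducedPseudoNoetherianOrder (R : Type w) (A : Type u) [CommRing R] [Ring A]
    [Algebra R A] : Prop where
  isPseudoNoetherianAlgebra : IsPseudoNoetherianAlgebra R A
  finite_fractions : Module.Finite (FractionRing R) (LocalizedModule R⁰ A)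
  hasNoNilpotentIdeals : HasNoNilpotentIdeals A
  torsionFree : ∀ r ∈ R⁰, ∀ x : A, r • x = 0 → x = 0

/-- `M_P = 0` for all prime ideals `P` of `R` of height one. -/
def IsPseudoZero (R : Type w) (M : Type v) [CommRing R] [AddCommGroup M] [Module R M] : Prop :=
  ∀ (P : Ideal R) [P.IsPrime], P.height = 1 → Subsingleton (LocalizedModule P.primeCompl M)

/-- An `A`-module `M` is codivisorial if its only submodule `N` such that `N_P = 0` for all prime
ideals `P` of `R` of height one is `0`. -/
def IsCodivisorial (R : Type w) (A : Type u) (M : Type v) [CommRing R] [Ring A] [Algebra R A]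
    [AddCommGroup M] [Module A M] [Module R M] [IsScalarTower R A M] : Prop :=
  ∀ N : Submodule A M, IsPseudoZero R N → N = ⊥

/-- A module is indecomposable if it is nonzero and is not a direct sum of two nonzero
submodules. -/
def IsIndecomposableModule (A : Type u) (M : Type v) [Ring A] [AddCommGroup M] [Module A M] :
    Prop :=
  Nontrivial M ∧ ∀ N N' : Submodule A M, IsCompl N N' → N = ⊥ ∨ N' = ⊥

/-!
# Injective codivisorial modules over reduced pseudo-noetherian orders

Up to submodules that vanish at all primes of height one, the order `A` is left noetherian
(`IsReducedPseudoNoetherianOrder.isPseudoNoetherianLeft`): every left ideal `I` has a finitely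
generated left ideal `I₀ ≤ I` with the same localizations at all primes of height one. Indeed, the
full ring of fractions `Q` of `R` is artinian, so `Q ⊗ A` is an artinian ring. Its nilpotent radical
meets `A` in zero, so `Q ⊗ A` is semisimple and `Q I` is generated by an idempotent `a / r` with
`a ∈ I` and `r` a regular element of `R`. Hence `r x = x a` for all `x ∈ I`, and `A a` already agrees
with `I` at every prime of height one that does not contain `r`. The primes of height one that
contain `r` are minimal over `r`, so there are finitely many, and at each of them finitely many
further generators suffice because `A_P` is left noetherian.

As codivisorial modules have no nonzero elements that vanish at all primes of height one, the usual
arguments for noetherian rings apply to them. A map from `I` to a directed union of injective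
submodules of a codivisorial module is determined by its values on `I₀`, which lie in one member of
the union; so the union is injective by Baer's criterion (`Module.Baer.iSup_of_directed`). This
gives the injectivity of direct sums (`Module.Baer.directSum`). It also allows one to choose, for a
nonzero element `x`, an injective submodule maximal among those not containing `x`; its complement is
indecomposable (`exists_indecomposable_baer`). A maximal independent set of indecomposable injective
submodules then decomposes the whole module (`exists_sSupIndep_indecomposable_baer`).

Injectivity is handled in the form of Baer's criterion, which makes no reference to universes.
-/

open scoped OreLocalization

/-! ### Baer modules -/

namespace Module.Baer

variable {A : Type*} [Ring A] {M N : Type*} [AddCommGroup M] [AddCommGroup N]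
  [Module A M] [Module A N]

theorem of_retract (h : Module.Baer A M) (i : N →ₗ[A] M) (p : M →ₗ[A] N)
    (hpi : ∀ x, p (i x) = x) : Module.Baer A N := fun I g ↦
  have ⟨g', hg'⟩ := h I (i ∘ₗ g)
  ⟨p ∘ₗ g', fun x hx ↦ by simp [hg' x hx, hpi]⟩

theorem of_isCompl (h : Module.Baer A M) {N C : Submodule A M} (hNC : IsCompl N C) :
    Module.Baer A N :=
  h.of_retract N.subtype (N.projectionOnto C hNC) (Submodule.projectionOnto_apply_left hNC)

theorem exists_retraction {N : Submodule A M} (h : Module.Baer A N) :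
    ∃ p : M →ₗ[A] N, ∀ x : N, p x = x :=
  have ⟨p, hp⟩ := h.extension_property N.subtype N.injective_subtype LinearMap.id
  ⟨p, fun x ↦ congr($hp x)⟩

theorem exists_isCompl {N : Submodule A M} (h : Module.Baer A N) : ∃ C, IsCompl N C :=
  have ⟨p, hp⟩ := h.exists_retraction
  ⟨LinearMap.ker p, LinearMap.isCompl_of_proj hp⟩

theorem sup {N C : Submodule A M} (hN : Module.Baer A N) (hC : Module.Baer A C)
    (h : Disjoint N C) : Module.Baer A ↥(N ⊔ C) := by
  have hprod : Module.Baer A (N × C) := fun I g ↦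
    have ⟨g₁, h₁⟩ := hN I (LinearMap.fst A N C ∘ₗ g)
    have ⟨g₂, h₂⟩ := hC I (LinearMap.snd A N C ∘ₗ g)
    ⟨g₁.prod g₂, fun x hx ↦ Prod.ext (h₁ x hx) (h₂ x hx)⟩
  have hinj : Function.Injective (N.subtype.coprod C.subtype) := by
    rw [← LinearMap.ker_eq_bot, LinearMap.ker_coprod_of_disjoint_range _ _ (by simpa using h)]
    simp
  have hr : LinearMap.range (N.subtype.coprod C.subtype) = N ⊔ C := by
    simp [LinearMap.range_coprod]
  exact hr ▸ hprod.of_equiv (LinearEquiv.ofInjective _ hinj)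

end Module.Baer

/-! ### Independent sets in modular lattices -/

theorem sSupIndep.insert_of_disjoint {α : Type*} [CompleteLattice α] [IsModularLattice α]
    {s : Set α} {a : α} (hs : sSupIndep s) (ha : Disjoint (sSup s) a) : sSupIndep (insert a s) := by
  rintro b (rfl | hb)
  · refine ha.symm.mono_right (sSup_le_sSup ?_)
    rintro c ⟨rfl | hc, hcb⟩
    exacts [(hcb rfl).elim, hc]
  · have hle : sSup (insert a s \ {b}) ≤ sSup (s \ {b}) ⊔ a := by
      refine sSup_le ?_
      rintro c ⟨rfl | hc, hcb⟩
      exacts [le_sup_right, le_sup_of_le_left (le_sSup ⟨hc, hcb⟩)]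
    refine Disjoint.mono_right hle
      ((hs hb).disjoint_sup_right_of_disjoint_sup_left (ha.mono_left ?_))
    exact sup_le (le_sSup hb) (sSup_le_sSup Set.sdiff_subset)

/-! ### Pseudo-null elements -/

/-- An element of an `R`-module is pseudo-null if its image in `M_P` is zero for every prime `P` of
height one. -/
def IsPseudoNull (R : Type*) {M : Type*} [CommRing R] [AddCommGroup M] [Module R M] (x : M) :
    Prop :=
  ∀ (P : Ideal R) [P.IsPrime], P.height = 1 → ∃ s ∉ P, s • x = 0

section

variable {R : Type*} {A : Type*} {M N : Type*} [CommRing R] [Ring A] [Algebra R A]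
  [AddCommGroup M] [Module A M] [Module R M] [IsScalarTower R A M]
  [AddCommGroup N] [Module A N] [Module R N] [IsScalarTower R A N]

theorem IsPseudoNull.map {x : M} (hx : IsPseudoNull R x) (f : M →ₗ[A] N) :
    IsPseudoNull R (f x) := fun P _ hP ↦
  have ⟨s, hs, h⟩ := hx P hP
  ⟨s, hs, by rw [← LinearMap.map_smul_of_tower, h, map_zero]⟩

theorem isCodivisorial_iff :
    IsCodivisorial R A M ↔ ∀ x : M, IsPseudoNull R x → x = 0 := by
  have key (P : Ideal R) [P.IsPrime] (N : Submodule A M) :=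
    IsLocalizedModule.subsingleton_iff P.primeCompl (LocalizedModule.mkLinearMap P.primeCompl N)
  refine ⟨fun h x hx ↦ ?_, fun h N hN ↦ ?_⟩
  · have := h (Submodule.span A {x}) fun P _ hP ↦ (key P _).2 fun ⟨y, hy⟩ ↦ by
      obtain ⟨a, rfl⟩ := Submodule.mem_span_singleton.1 hy
      obtain ⟨s, hs, h⟩ := hx P hP
      have := IsScalarTower.to_smulCommClass (R := R) (A := A) (M := M)
      exact ⟨s, hs, Subtype.ext (by simp [smul_comm s a x, h])⟩
    simpa using this
  · refine (Submodule.eq_bot_iff _).2 fun x hx ↦ h x fun P _ hP ↦ ?_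
    obtain ⟨s, hs, h⟩ := (key P N).1 (hN P hP) ⟨x, hx⟩
    exact ⟨s, hs, congr($h)⟩

theorem IsCodivisorial.of_injective (h : IsCodivisorial R A N) (f : M →ₗ[A] N)
    (hf : Function.Injective f) : IsCodivisorial R A M :=
  isCodivisorial_iff.2 fun x hx ↦ hf <| by
    rw [map_zero]; exact isCodivisorial_iff.1 h _ (hx.map f)

theorem IsIndecomposableModule.of_equiv (h : IsIndecomposableModule A M) (e : M ≃ₗ[A] N) :
    IsIndecomposableModule A N := by
  refine ⟨have := h.1; e.symm.toEquiv.nontrivial, fun C D hCD ↦ ?_⟩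
  have := h.2 _ _ (((Submodule.orderIsoMapComap e.symm).isCompl_iff).1 hCD)
  simpa using this

end

/-! ### Direct sums and decompositions of codivisorial Baer modules -/

/-- Every left ideal `I` of `A` is finitely generated up to a pseudo-null quotient: some finitely
generated `I₀ ≤ I` has `I₀_P = I_P` for all primes `P` of `R` of height one. The last condition is
spelled out on elements. -/
def IsPseudoNoetherianLeft (R A : Type*) [CommRing R] [Ring A] [Algebra R A] : Prop :=
  ∀ I : Ideal A, ∃ I₀ : Ideal A, I₀ ≤ I ∧ I₀.FG ∧
    ∀ x ∈ I, ∀ (P : Ideal R) [P.IsPrime], P.height = 1 → ∃ s ∉ P, s • x ∈ I₀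

section

variable {R A M : Type*} [CommRing R] [Ring A] [Algebra R A]
  [AddCommGroup M] [Module A M] [Module R M] [IsScalarTower R A M]

/-- In a codivisorial module, a directed union of Baer submodules is Baer. A map from a left ideal `I`
sends a finitely generated approximation `I₀` of `I` into one member `N k` of the family. Since `N k`
is a direct summand, the component of the map off `N k` vanishes on `I₀`, so that it has pseudo-null
values and is zero. -/
theorem Module.Baer.iSup_of_directed (hA : IsPseudoNoetherianLeft R A)
    (hM : IsCodivisorial R A M) {κ : Type*} [Nonempty κ] (N : κ → Submodule A M)
    (hdir : Directed (· ≤ ·) N) (hN : ∀ k, Module.Baer A (N k)) :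
    Module.Baer A ↥(⨆ k, N k) := fun I g ↦ by
  obtain ⟨I₀, hle, hfg, hI⟩ := hA I
  let f : I →ₗ[A] M := (⨆ k, N k).subtype ∘ₗ g
  obtain ⟨k, hk⟩ : ∃ k, ∀ x (hx : x ∈ I₀), f ⟨x, hle hx⟩ ∈ N k := by
    have := Module.Finite.iff_fg.2 hfg
    let f₀ : I₀ →ₗ[A] M := f ∘ₗ Submodule.inclusion hle
    have hcpt := (Submodule.fg_iff_compact _).1 (Module.Finite.iff_fg.1 (Module.Finite.range f₀))
    rw [CompleteLattice.isCompactElement_iff_le_of_directed_sSup_le] at hcpt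
    obtain ⟨_, ⟨k, rfl⟩, hk⟩ := hcpt (Set.range N) (Set.range_nonempty N) hdir.directedOn_range <| by
      rintro _ ⟨x, rfl⟩
      rw [sSup_range]
      exact (g _).2
    exact ⟨k, fun x hx ↦ hk ⟨⟨x, hx⟩, rfl⟩⟩
  obtain ⟨p, hp⟩ := (hN k).exists_retraction
  have hf (x : I) : f x = p (f x) := by
    rw [← sub_eq_zero]
    refine isCodivisorial_iff.1 hM _ fun P _ hP ↦ ?_
    obtain ⟨s, hs, hsx⟩ := hI x x.2 P hP
    have h₁ : f (s • x) ∈ N k := hk _ hsx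
    refine ⟨s, hs, ?_⟩
    have h₂ : ((p (f (s • x)) : N k) : M) = f (s • x) := congr((($(hp ⟨_, h₁⟩) : N k) : M))
    rw [f.map_smul_of_tower, p.map_smul_of_tower] at h₂
    rw [smul_sub, sub_eq_zero]
    exact h₂.symm
  obtain ⟨g', hg'⟩ := hN k I (p ∘ₗ f)
  refine ⟨Submodule.inclusion (le_iSup N k) ∘ₗ g', fun x hx ↦ Subtype.ext ?_⟩
  rw [LinearMap.comp_apply, Submodule.coe_inclusion, hg' x hx]
  exact (hf ⟨x, hx⟩).symm

/-- The direct sum is the directed union of the submodules of elements supported in a finite set. -/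
theorem Module.Baer.directSum (hA : IsPseudoNoetherianLeft R A) {ι : Type*} (M : ι → Type*)
    [∀ i, AddCommGroup (M i)] [∀ i, Module A (M i)] [∀ i, Module R (M i)]
    [∀ i, IsScalarTower R A (M i)] (hM : ∀ i, Module.Baer A (M i))
    (hcod : ∀ i, IsCodivisorial R A (M i)) : Module.Baer A (⨁ i, M i) := by
  classical
  have hc : IsCodivisorial R A (⨁ i, M i) := isCodivisorial_iff.2 fun x hx ↦
    DFinsupp.ext fun i ↦ isCodivisorial_iff.1 (hcod i) _ (hx.map (DirectSum.component A ι M i))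
  let N (F : Finset ι) : Submodule A (⨁ i, M i) :=
    ⨅ i : {i // i ∉ F}, LinearMap.ker (DirectSum.component A ι M i)
  have hmem {F x} : x ∈ N F ↔ ∀ i ∉ F, x i = 0 := by
    simp [N, Submodule.mem_iInf]; rfl
  have hdir : Directed (· ≤ ·) N := Monotone.directed_le fun F G hFG x hx ↦
    hmem.2 fun i hi ↦ hmem.1 hx i fun h ↦ hi (Finset.mem_of_subset hFG h)
  have htop : ⨆ F, N F = ⊤ := eq_top_iff.2 fun x _ ↦
    (le_iSup N (DFinsupp.support x)) (hmem.2 fun i hi ↦ by simpa using hi)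
  have hN (F) : Module.Baer A (N F) := fun I g ↦ by
    choose g' hg' using fun i ↦ hM i I (DirectSum.component A ι M i ∘ₗ (N F).subtype ∘ₗ g)
    let G : A →ₗ[A] ⨁ i, M i := ∑ i ∈ F, DirectSum.lof A ι M i ∘ₗ g' i
    have hG (x i) : G x i = if i ∈ F then g' i x else 0 := by
      simp [G, DirectSum.lof_eq_of, DirectSum.of_apply]
    refine ⟨G.codRestrict (N F) fun x ↦ hmem.2 fun i hi ↦ by simp [hG, hi], fun x hx ↦ ?_⟩
    refine Subtype.ext (DFinsupp.ext fun i ↦ (hG x i).trans ?_)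
    split_ifs with hi
    · exact hg' i x hx
    · exact (hmem.1 (g ⟨x, hx⟩).2 i hi).symm
  have := Module.Baer.iSup_of_directed hA hc N hdir hN
  rw [htop] at this
  exact this.of_equiv Submodule.topEquiv

theorem Module.Baer.iSup_of_iSupIndep (hA : IsPseudoNoetherianLeft R A)
    (hM : IsCodivisorial R A M) {ι : Type*} (N : ι → Submodule A M) (hind : iSupIndep N)
    (hN : ∀ i, Module.Baer A (N i)) : Module.Baer A ↥(⨆ i, N i) := by
  classical
  have h := Module.Baer.directSum hA (fun i ↦ N i) hN
    fun i ↦ hM.of_injective (N i).subtype (N i).injective_subtype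
  have hinj : Function.Injective (DirectSum.coeLinearMap N) := hind.dfinsupp_lsum_injective
  exact DirectSum.range_coeLinearMap (A := N) ▸ h.of_equiv (LinearEquiv.ofInjective _ hinj)

/-- For `x ≠ 0`, a complement of a Baer submodule that is maximal among those not containing `x` is
indecomposable. -/
theorem exists_indecomposable_baer [Nontrivial M] (hA : IsPseudoNoetherianLeft R A)
    (hM : IsCodivisorial R A M) (hB : Module.Baer A M) :
    ∃ C : Submodule A M, Module.Baer A C ∧ IsIndecomposableModule A C := by
  obtain ⟨x, hx⟩ := exists_ne (0 : M)
  obtain ⟨N, hN⟩ : ∃ N : Submodule A M,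
      Maximal (· ∈ {N : Submodule A M | Module.Baer A N ∧ x ∉ N}) N := by
    refine zorn_le₀ _ fun c hc hchain ↦ ?_
    rcases c.eq_empty_or_nonempty with rfl | hne
    · exact ⟨⊥, ⟨fun I g ↦ ⟨0, fun _ _ ↦ Subsingleton.elim _ _⟩, hx⟩, by simp⟩
    · have := hne.to_subtype
      have hdir : Directed (· ≤ ·) (fun N : c ↦ (N : Submodule A M)) :=
        hchain.directedOn.directed_val
      refine ⟨sSup c, ⟨?_, fun h ↦ ?_⟩, fun N hN ↦ le_sSup hN⟩
      · rw [sSup_eq_iSup']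
        exact Module.Baer.iSup_of_directed hA hM _ hdir fun N ↦ (hc N.2).1
      · obtain ⟨N, hN, hxN⟩ := (Submodule.mem_sSup_of_directed hne hchain.directedOn).1 h
        exact (hc hN).2 hxN
  obtain ⟨⟨hNB, hxN⟩, hmax⟩ := hN
  obtain ⟨C, hC⟩ := hNB.exists_isCompl
  have hCB := hB.of_isCompl hC.symm
  refine ⟨C, hCB, ?_, fun D₁ D₂ hD ↦ ?_⟩
  · rw [Submodule.nontrivial_iff_ne_bot]
    rintro rfl
    exact hxN (by simp [show N = ⊤ by simpa using hC.sup_eq_top])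
  · by_contra! h
    -- By maximality of `N`, enlarging it by a nonzero summand `D` of `C` captures `x`.
    have key {D : Submodule A C} (hDB : Module.Baer A D) (hD : D ≠ ⊥) :
        ∃ d ∈ D, x - d ∈ N := by
      have hle : D.map C.subtype ≤ C := Submodule.map_subtype_le C D
      have hdis : Disjoint N (D.map C.subtype) := hC.disjoint.mono_right hle
      have hsup := hNB.sup
        (hDB.of_equiv (Submodule.equivMapOfInjective _ C.injective_subtype D)) hdis
      have hxs : x ∈ N ⊔ D.map C.subtype := by
        by_contra hxs
        have : D.map C.subtype ≤ N := le_sup_right.trans (hmax ⟨hsup, hxs⟩ le_sup_left)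
        have := hdis.eq_bot_of_ge this
        exact hD (Submodule.map_injective_of_injective C.injective_subtype (by simpa using this))
      obtain ⟨n, hn, _, ⟨d, hd, rfl⟩, rfl⟩ := Submodule.mem_sup.1 hxs
      exact ⟨d, hd, by simpa⟩
    obtain ⟨d₁, hd₁, h₁⟩ := key (hCB.of_isCompl hD) h.1
    obtain ⟨d₂, hd₂, h₂⟩ := key (hCB.of_isCompl hD.symm) h.2
    have h₁₂ : d₁ = d₂ := by
      have : ((d₁ - d₂ : C) : M) ∈ N := by simpa using N.sub_mem h₂ h₁
      have := Submodule.disjoint_def.1 hC.disjoint _ this (d₁ - d₂).2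
      exact sub_eq_zero.1 (Subtype.ext this)
    have : d₁ = 0 := Submodule.disjoint_def.1 hD.disjoint _ hd₁ (h₁₂ ▸ hd₂)
    exact hxN (by simpa [this] using h₁)

/-- A maximal independent set of indecomposable Baer submodules spans: its sum is Baer, hence has a
complement, which would otherwise contain a further indecomposable Baer submodule. -/
theorem exists_sSupIndep_indecomposable_baer (hA : IsPseudoNoetherianLeft R A)
    (hM : IsCodivisorial R A M) (hB : Module.Baer A M) :
    ∃ S : Set (Submodule A M), sSupIndep S ∧ sSup S = ⊤ ∧
      ∀ N ∈ S, Module.Baer A N ∧ IsIndecomposableModule A N := by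
  obtain ⟨S, ⟨hind, hS⟩, hmax⟩ : ∃ S : Set (Submodule A M), Maximal
      (· ∈ {S : Set (Submodule A M) | sSupIndep S ∧
        ∀ N ∈ S, Module.Baer A N ∧ IsIndecomposableModule A N}) S := by
    refine zorn_subset _ fun c hc hchain ↦
      ⟨⋃₀ c, ⟨?_, fun N ⟨S, hS, hN⟩ ↦ (hc hS).2 N hN⟩, fun S hS ↦ Set.subset_sUnion_of_mem hS⟩
    rw [Set.sUnion_eq_iUnion]
    exact sSupIndep_iUnion_of_directed hchain.directedOn.directed_val
      fun S ↦ (hc S.2).1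
  refine ⟨S, hind, ?_, hS⟩
  have hSB : Module.Baer A ↥(sSup S) := by
    rw [sSup_eq_iSup']
    exact Module.Baer.iSup_of_iSupIndep hA hM _ ((sSupIndep_iff S).1 hind) fun N ↦ (hS N N.2).1
  obtain ⟨C, hC⟩ := hSB.exists_isCompl
  by_contra hne
  have hCne : C ≠ ⊥ := fun h ↦ hne (by simpa [h] using hC.sup_eq_top)
  have : Nontrivial C := (Submodule.nontrivial_iff_ne_bot).2 hCne
  obtain ⟨D, hDB, hDI⟩ := exists_indecomposable_baer hA
    (hM.of_injective C.subtype C.injective_subtype) (hB.of_isCompl hC.symm)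
  let e := Submodule.equivMapOfInjective _ C.injective_subtype D
  set D' := D.map C.subtype
  have hdis : Disjoint (sSup S) D' := hC.disjoint.mono_right (Submodule.map_subtype_le C D)
  have hD'I := hDI.of_equiv e
  have hins : sSupIndep (insert D' S) := hind.insert_of_disjoint hdis
  have hmem : D' ∈ S := hmax ⟨hins, fun N hN ↦ hN.elim
    (fun h ↦ h ▸ ⟨hDB.of_equiv e, hD'I⟩) (hS N)⟩ (Set.subset_insert _ _) (Set.mem_insert _ _)
  have hbot : D' = ⊥ := hdis.symm.eq_bot_of_le (le_sSup hmem)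
  exact (Submodule.nontrivial_iff_ne_bot.1 hD'I.1) hbot

end

/-! ### The full ring of fractions and the order over it -/

/-- A semilocal ring with zero Jacobson radical is artinian, as it embeds into a finite product of
fields. -/
theorem isArtinianRing_of_finite_maximalSpectrum (Q : Type*) [CommRing Q]
    [Finite (MaximalSpectrum Q)] (h : ∀ x : Q, (∀ m : Ideal Q, m.IsMaximal → x ∈ m) → x = 0) :
    IsArtinianRing Q := by
  let f : Q →ₗ[Q] ∀ m : MaximalSpectrum Q, Q ⧸ m.asIdeal :=
    LinearMap.pi fun m ↦ Submodule.mkQ m.asIdeal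
  have hf : Function.Injective f := by
    refine (injective_iff_map_eq_zero f).2 fun x hx ↦ h x fun m hm ↦ ?_
    exact (Submodule.Quotient.mk_eq_zero _).1 (congr_fun hx ⟨m, hm⟩)
  have (m : MaximalSpectrum Q) : IsSimpleModule Q (Q ⧸ m.asIdeal) :=
    isSimpleModule_iff_isCoatom.2 m.isMaximal.out
  exact isArtinian_of_injective f hf

theorem exists_mem_minimalPrimes_of_notMem_nonZeroDivisors {R : Type*} [CommRing R] [IsReduced R]
    {r : R} (hr : r ∉ R⁰) : ∃ p ∈ minimalPrimes R, r ∈ p := by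
  obtain ⟨x, hx, hx0⟩ : ∃ x, r * x = 0 ∧ x ≠ 0 := by
    simpa [mem_nonZeroDivisors_iff_right, mul_comm] using hr
  have : (r : R) ∈ ⋃ p ∈ (⊥ : Ideal R).minimalPrimes, (p : Set R) := by
    rw [Ideal.iUnion_minimalPrimes]
    exact ⟨x, by simpa [Ideal.radical_bot_of_isReduced] using hx0, by simp [hx]⟩
  simpa [minimalPrimes] using this

/-- Every maximal ideal of the full ring of fractions contracts to a minimal prime of `R`: the
contraction consists of zero divisors, so prime avoidance puts it inside one of the finitely many
minimal primes. -/
theorem IsPseudoNoetherianRing.isArtinianRing_fractionRing {R : Type*} [CommRing R] [IsReduced R]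
    (hR : IsPseudoNoetherianRing R) : IsArtinianRing (FractionRing R) := by
  have hfin : (minimalPrimes R).Finite := by
    simpa [minimalPrimes] using hR.finite_minimalPrimes 0
  have hcomap (m : Ideal (FractionRing R)) (hm : m.IsMaximal) :
      m.comap (algebraMap R _) ∈ minimalPrimes R := by
    have hdis := ((IsLocalization.isPrime_iff_isPrime_disjoint R⁰ _ m).1 hm.isPrime).2
    have hsub : (m.comap (algebraMap R (FractionRing R)) : Set R) ⊆
        ⋃ p ∈ minimalPrimes R, (p : Set R) := fun x hx ↦ by
      obtain ⟨p, hp, hxp⟩ := exists_mem_minimalPrimes_of_notMem_nonZeroDivisors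
        (fun h ↦ Set.disjoint_left.1 hdis h hx)
      exact Set.mem_biUnion hp hxp
    obtain ⟨p, hp, hle⟩ := (Ideal.subset_union_prime_finite hfin (f := id) ⊥ ⊥
      fun p hp _ _ ↦ Ideal.IsMinimalPrime.isPrime hp).1 hsub
    have := hm.isPrime.comap (algebraMap R (FractionRing R))
    exact hle.antisymm (hp.2 ⟨this, bot_le⟩ hle) ▸ hp
  have : Finite (MaximalSpectrum (FractionRing R)) := by
    have := hfin.to_subtype
    refine Finite.of_injective (β := minimalPrimes R)
      (fun m ↦ ⟨m.asIdeal.comap (algebraMap R _), hcomap _ m.isMaximal⟩) fun m n h ↦ ?_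
    exact MaximalSpectrum.ext ((IsLocalization.orderEmbedding R⁰ (FractionRing R)).injective
      (Subtype.ext_iff.1 h))
  refine isArtinianRing_of_finite_maximalSpectrum _ fun x hx ↦ ?_
  obtain ⟨r, s, rfl⟩ := IsLocalization.exists_mk'_eq R⁰ x
  -- Each minimal prime of `R` is the contraction of a maximal ideal, so `r` lies in the nilradical.
  have hr : r = 0 := by
    have : r ∈ nilradical R := by
      rw [nilradical_eq_sInf, Ideal.mem_sInf]
      intro q (hq : q.IsPrime)
      obtain ⟨p, hp, hpq⟩ := Ideal.exists_minimalPrimes_le (bot_le (a := q))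
      have hpp : p.IsPrime := hp.1.1
      have hne : p.map (algebraMap R (FractionRing R)) ≠ ⊤ := by
        exact (IsLocalization.isPrime_of_isPrime_disjoint R⁰ _ p hpp
          (Ideal.disjoint_nonZeroDivisors_of_mem_minimalPrimes hp).symm).ne_top
      obtain ⟨m, hm, hpm⟩ := Ideal.exists_le_maximal _ hne
      have hmin := hcomap m hm
      have hle := hmin.2 ⟨hpp, bot_le⟩ (Ideal.map_le_iff_le_comap.1 hpm)
      refine hpq (hle ?_)
      exact (IsLocalization.mk'_mem_iff).1 (hx m hm)
    simpa using this
  simp [hr]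

/-- The action of `S⁻¹R` meant here is the one of Ore localization, on which the instance
`Module (FractionRing R) (LocalizedModule R⁰ A)` is based. -/
theorem LocalizedModule.isScalarTower_localization {R A : Type*} [CommRing R] [Ring A]
    [Algebra R A] (S : Submonoid R) :
    IsScalarTower (Localization S) (LocalizedModule S A) (LocalizedModule S A) := by
  have smul_mk (r : R) (s t : S) (a : A) :
      ((r /ₒ s : Localization S) • mk a t : LocalizedModule S A) = mk (r • a) (s * t) := by
    rw [mul_comm]
    exact OreLocalization.oreDiv_smul_char r a s t r t (mul_comm _ _)
  refine ⟨fun q x y ↦ ?_⟩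
  induction q using OreLocalization.ind with | _ r s
  induction x using LocalizedModule.induction_on with | _ a t
  induction y using LocalizedModule.induction_on with | _ b u
  simp only [smul_mk, smul_eq_mul, mk_mul_mk, smul_mul_assoc, mul_assoc]

/-- The Jacobson radical of the artinian ring `Q ⊗ A` is nilpotent, so it meets `A` in a nilpotent
two-sided ideal, which is zero. -/
theorem IsReducedPseudoNoetherianOrder.isSemisimpleRing {R A : Type*} [CommRing R] [IsReduced R]
    [Ring A] [Algebra R A] (hR : IsPseudoNoetherianRing R)
    (hA : IsReducedPseudoNoetherianOrder R A) : IsSemisimpleRing (LocalizedModule R⁰ A) := by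
  have := hR.isArtinianRing_fractionRing
  have := hA.finite_fractions
  have : IsScalarTower (FractionRing R) (LocalizedModule R⁰ A) (LocalizedModule R⁰ A) :=
    LocalizedModule.isScalarTower_localization R⁰
  have : IsArtinianRing (LocalizedModule R⁰ A) :=
    IsArtinianRing.of_finite (FractionRing R) _
  rw [IsArtinianRing.isSemisimpleRing_iff_jacobson]
  let φ : A →+* LocalizedModule R⁰ A := LocalizedModule.numeratorRingHom
  have hφ : Function.Injective φ := (injective_iff_map_eq_zero φ).2 fun a ha ↦ by
    obtain ⟨r, hr⟩ := LocalizedModule.mk_eq.1 (ha.trans (LocalizedModule.zero_mk 1).symm)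
    exact hA.torsionFree r r.2 a (by simpa [Submonoid.smul_def] using hr)
  set J := Ring.jacobson (LocalizedModule R⁰ A)
  obtain ⟨n, hn⟩ : IsNilpotent J := IsSemiprimaryRing.isNilpotent
  have hpow (k : ℕ) : (J.comap φ) ^ k ≤ (J ^ k).comap φ := by
    induction k with
    | zero => simp [Submodule.pow_zero, Ideal.one_eq_top]
    | succ k ih =>
      rw [Ideal.IsTwoSided.pow_succ, Ideal.IsTwoSided.pow_succ, Ideal.mul_le]
      exact fun a ha b hb ↦ by
        rw [Ideal.mem_comap, map_mul]
        exact Ideal.mul_mem_mul ha (ih hb)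
  have hbot := hA.hasNoNilpotentIdeals (J.comap φ) inferInstance ⟨n, le_bot_iff.1 <|
    (hpow n).trans fun a ha ↦ by
      rw [hn] at ha
      exact hφ ((show φ a = 0 from ha).trans (map_zero φ).symm)⟩
  refine (Submodule.eq_bot_iff _).2 fun x hx ↦ ?_
  induction x using LocalizedModule.induction_on with
  | h a s =>
    have : a ∈ J.comap φ := by
      have := J.mul_mem_left (φ (algebraMap R A s)) hx
      rw [Ideal.mem_comap]
      convert this using 1
      simp only [φ, RingHom.coe_mk, MonoidHom.coe_mk, OneHom.coe_mk, LocalizedModule.mk_mul_mk,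
        one_mul, ← Algebra.smul_def]
      exact (LocalizedModule.mk_cancel s a).symm
    rw [hbot] at this
    rw [(Submodule.mem_bot A).1 this, LocalizedModule.zero_mk]

/-- The left ideal `S⁻¹I` of `S⁻¹A` of all fractions with numerator in the left ideal `I`. -/
def Ideal.localizedModule {R A : Type*} [CommRing R] [Ring A] [Algebra R A] (S : Submonoid R)
    (I : Ideal A) : Ideal (LocalizedModule S A) where
  carrier := {y | ∃ a ∈ I, ∃ s, y = .mk a s}
  zero_mem' := ⟨0, I.zero_mem, 1, (LocalizedModule.zero_mk 1).symm⟩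
  add_mem' := by
    rintro _ _ ⟨a, ha, s, rfl⟩ ⟨b, hb, t, rfl⟩
    refine ⟨t • a + s • b, I.add_mem ?_ ?_, s * t, LocalizedModule.mk_add_mk⟩
    exacts [Submodule.smul_of_tower_mem I (t : R) ha, Submodule.smul_of_tower_mem I (s : R) hb]
  smul_mem' := by
    rintro y _ ⟨a, ha, s, rfl⟩
    induction y using LocalizedModule.induction_on with
    | h b t => exact ⟨b * a, I.mul_mem_left b ha, t * s, LocalizedModule.mk_mul_mk⟩

/-- The left ideal of `Q ⊗ A` generated by `I` is generated by an idempotent `a / r` with `a ∈ I`, and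
right multiplication by this idempotent is the identity on `I`. -/
theorem IsReducedPseudoNoetherianOrder.exists_mem_smul_eq_mul {R A : Type*} [CommRing R]
    [IsReduced R] [Ring A] [Algebra R A] (hR : IsPseudoNoetherianRing R)
    (hA : IsReducedPseudoNoetherianOrder R A) (I : Ideal A) :
    ∃ a ∈ I, ∃ r ∈ R⁰, ∀ x ∈ I, r • x = x * a := by
  have := hA.isSemisimpleRing hR
  let I' := I.localizedModule (R := R) R⁰
  obtain ⟨e, he, hI'⟩ := IsSemisimpleRing.ideal_eq_span_idempotent I'
  obtain ⟨a, ha, r, rfl⟩ : e ∈ I' := hI' ▸ Ideal.mem_span_singleton_self e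
  refine ⟨a, ha, r, r.2, fun x hx ↦ ?_⟩
  have hx' : (.mk x 1 : LocalizedModule R⁰ A) ∈ I' := ⟨x, hx, 1, rfl⟩
  rw [hI', Ideal.mem_span_singleton'] at hx'
  obtain ⟨y, hy⟩ := hx'
  have h : (.mk x 1 : LocalizedModule R⁰ A) * .mk a r = .mk x 1 := by
    rw [← hy, mul_assoc, he.eq]
  rw [LocalizedModule.mk_mul_mk, LocalizedModule.mk_eq] at h
  obtain ⟨u, hu⟩ := h
  refine (sub_eq_zero.1 (hA.torsionFree u u.2 _ ?_)).symm
  rw [smul_sub, sub_eq_zero]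
  simpa [Submonoid.smul_def] using hu

/-! ### Finite generation of left ideals up to pseudo-null quotients -/

theorem mem_minimalPrimes_span_of_height_eq_one {R : Type*} [CommRing R] {r : R} (hr : r ∈ R⁰)
    {P : Ideal R} [P.IsPrime] (hP : P.height = 1) (hrP : r ∈ P) :
    P ∈ (Ideal.span {r}).minimalPrimes := by
  refine ⟨⟨‹_›, by simpa using hrP⟩, fun q ⟨hq, hrq⟩ hqP ↦ ?_⟩
  by_contra hne
  have hlt := Ideal.height_add_one_le_of_lt_of_isPrime (lt_of_le_not_ge hqP hne)
  rw [hP] at hlt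
  have h0 : q.height = 0 := by
    have hlt' : q.height + 1 ≤ 0 + 1 := by rwa [zero_add]
    exact nonpos_iff_eq_zero.1 ((ENat.add_le_add_iff_right ENat.one_ne_top).1 hlt')
  exact Set.disjoint_left.1 (Ideal.disjoint_nonZeroDivisors_of_mem_minimalPrimes
    (Ideal.height_eq_zero_iff.1 h0)) (by simpa using hrq) hr

theorem Ideal.exists_fg_le_forall_exists_smul_mem {R A : Type*} [CommRing R] [Ring A] [Algebra R A]
    (S : Submonoid R) [IsNoetherianRing (LocalizedModule S A)] (I : Ideal A) :
    ∃ I₀ ≤ I, I₀.FG ∧ ∀ x ∈ I, ∃ s ∈ S, s • x ∈ I₀ := by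
  classical
  let T : Set (LocalizedModule S A) := (fun a ↦ .mk a 1) '' (I : Set A)
  obtain ⟨t, htT, ht⟩ := (Submodule.fg_span_iff_fg_span_finset_subset T).1
    (IsNoetherian.noetherian (Ideal.span T))
  obtain ⟨u, huI, rfl⟩ := Finset.subset_set_image_iff.1 htT
  refine ⟨Ideal.span u, Ideal.span_le.2 huI, ⟨u, rfl⟩, fun x hx ↦ ?_⟩
  have hle : Ideal.span T ≤ (Ideal.span (u : Set A)).localizedModule S := by
    rw [Ideal.span, ht, Submodule.span_le]
    intro y hy
    obtain ⟨b, hb, rfl⟩ := Finset.mem_image.1 hy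
    exact ⟨b, Ideal.subset_span hb, 1, rfl⟩
  obtain ⟨b, hb, s, hxs⟩ := hle (Ideal.subset_span ⟨x, hx, rfl⟩)
  obtain ⟨v, hv⟩ := LocalizedModule.mk_eq.1 hxs
  refine ⟨v * s, (v * s).2, ?_⟩
  have : ((v * s : S) : R) • x = (v : R) • b := by simpa [mul_smul, Submonoid.smul_def] using hv
  rw [Submonoid.coe_mul] at this
  rw [this]
  exact Submodule.smul_of_tower_mem _ (v : R) hb

/-- If `a ∈ I` and the regular element `r` satisfy `r x = x a` on `I`, then `A a` agrees with `I` at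
all primes of height one not containing `r`. Only finitely many such primes contain `r`, and `I` is
finitely generated at each of them. -/
theorem IsReducedPseudoNoetherianOrder.isPseudoNoetherianLeft {R A : Type*} [CommRing R]
    [IsReduced R] [Ring A] [Algebra R A] (hR : IsPseudoNoetherianRing R)
    (hA : IsReducedPseudoNoetherianOrder R A) : IsPseudoNoetherianLeft R A := by
  intro I
  obtain ⟨a, ha, r, hr, hra⟩ := hA.exists_mem_smul_eq_mul hR I
  have hfin := (hR.finite_minimalPrimes r).to_subtype
  have hex (P : (Ideal.span {r}).minimalPrimes) : ∃ I₀ ≤ I, I₀.FG ∧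
      (P.1.height = 1 → ∀ x ∈ I, ∃ s ∉ P.1, s • x ∈ I₀) := by
    have : P.1.IsPrime := P.2.1.1
    by_cases hP : P.1.height = 1
    · have := (hA.isPseudoNoetherianAlgebra P.1 hP.le).1
      obtain ⟨I₀, h₁, h₂, h₃⟩ := Ideal.exists_fg_le_forall_exists_smul_mem P.1.primeCompl I
      exact ⟨I₀, h₁, h₂, fun _ ↦ h₃⟩
    · exact ⟨⊥, bot_le, Submodule.fg_bot, fun h ↦ (hP h).elim⟩
  choose I₀ hle hfg hI₀ using hex
  refine ⟨Ideal.span {a} ⊔ ⨆ P, I₀ P, sup_le (by simpa [Ideal.span_le] using ha) (iSup_le hle),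
    (Submodule.fg_span_singleton a).sup (Submodule.fg_iSup _ hfg), fun x hx P _ hP ↦ ?_⟩
  by_cases hrP : r ∈ P
  · let P' : (Ideal.span {r}).minimalPrimes :=
      ⟨P, mem_minimalPrimes_span_of_height_eq_one hr hP hrP⟩
    obtain ⟨s, hs, hsx⟩ := hI₀ P' hP x hx
    exact ⟨s, hs, le_sup_of_le_right (le_iSup I₀ P') hsx⟩
  · refine ⟨r, hrP, Submodule.mem_sup_left ?_⟩
    rw [hra x hx]
    exact Ideal.mul_mem_left _ x (Ideal.mem_span_singleton_self a)

theorem theorem2 (R : Type w) (A : Type u) [CommRing R] [IsReduced R] [Ring A] [Algebra R A]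
    (hR : IsPseudoNoetherianRing R) (hA : IsReducedPseudoNoetherianOrder R A) [Small.{v} A] :
    (∀ (ι : Type t) (M : ι → Type v) [∀ i, AddCommGroup (M i)] [∀ i, Module A (M i)]
        [∀ i, Module R (M i)] [∀ i, IsScalarTower R A (M i)],
        (∀ i, IsIndecomposableModule A (M i) ∧ Module.Injective A (M i) ∧
          IsCodivisorial R A (M i)) →
        Module.Injective A (⨁ i, M i)) ∧
    (∀ (E : Type v) [AddCommGroup E] [Module A E] [Module R E] [IsScalarTower R A E],
        Module.Injective A E → IsCodivisorial R A E →
        ∃ (ι : Type v) (_ : DecidableEq ι) (N : ι → Submodule A E),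
          DirectSum.IsInternal N ∧
          ∀ i, IsIndecomposableModule A (N i) ∧ Module.Injective A (N i) ∧
            IsCodivisorial R A (N i)) := by
  classical
  have hP := hA.isPseudoNoetherianLeft hR
  refine ⟨fun ι M _ _ _ _ h ↦ ?_, fun E _ _ _ _ hE hcod ↦ ?_⟩
  · exact (Module.Baer.directSum hP M (fun i ↦ Module.Baer.of_injective (h i).2.1)
      fun i ↦ (h i).2.2).injective
  · obtain ⟨S, hind, htop, hS⟩ := exists_sSupIndep_indecomposable_baer hP hcod
      (Module.Baer.of_injective hE)
    refine ⟨S, inferInstance, fun N ↦ N, ?_, fun N ↦ ⟨(hS N N.2).2, (hS N N.2).1.injective,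
      hcod.of_injective N.1.subtype N.1.injective_subtype⟩⟩
    exact DirectSum.isInternal_submodule_of_iSupIndep_of_iSup_eq_top ((sSupIndep_iff S).1 hind)
      (by rwa [← sSup_eq_iSup'])
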